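/- **Theorem 5.1.** Let $A$ be a limit cut complete MV-algebra. (All notions are spelled out below.) (i) Let $a\le b$ in $A$, and suppose that $\iota([a,b])$ is dense in $[\widehat a,\widehat b]=\{\alpha\in[0,1]^{\operatorname{Max}A}:\widehat a\le\alpha\le\widehat b\}$ in at least one of the following senses: - (order density) whenever $\alpha<\beta$ in $[\widehat a,\widehat b]$ there is $c\in[a,b]$ with $\alpha\le\widehat c\le\beta$; - (density as in order completions) every element of $[\widehat a,\widehat b]$ is both a supremum and an infimum, in $[0,1]^{\operatorname{Max}A}$, of elements of $\iota([a,b])$; - (uniform density) for all $\alpha\in[\widehat a,\widehat b]$ and $\varepsilon>0$ there is $c\in[a,b]$ with $|\widehat c(M)-\alpha(M)|\le\varepsilon$ for all $M\in\operatorname{Max}A$. Then $\iota([a,b])=[\widehat a,\widehat b]$. (ii) $A$ is a subdirect product of complete MV-chains. More precisely, the canonical map $A\to\prod_{M\in\operatorname{Max}A}A/M$ is an injective homomorphism (each of whose components $A\to A/M$ is onto), and for every maximal ideal $M$ the quotient $A/M$ is totally ordered and complete (every subset has a supremum), and is isomorphic either to the standard MV-algebra $[0,1]$ or, for some integer $n\ge1$,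 to the finite Łukasiewicz chain $\{0,\tfrac1n,\dots,\tfrac{n-1}n,1\}\subseteq[0,1]$. **Notions.** In an MV-algebra $\langle A,\oplus,{}^*,0\rangle$ put $1=0^*$; $a\le b$ iff $a^*\oplus b=1$; $a\ominus b=(a^*\oplus b)^*$; $d(a,b)=(a\ominus b)\oplus(b\ominus a)$; $[a,b]=\{x\in A:a\le x\le b\}$. The standard MV-algebra is $[0,1]$ with $x\oplus y=\min(1,x+y)$ and $x^*=1-x$. $A$ is simple if its only proper ideal is $\{0\}$, and semisimple if it is a subdirect product of simple MV-algebras. $\operatorname{Max}A$ is the set of maximal ideals of $A$; for $M\in\operatorname{Max}A$ let $\iota_M:A/M\to[0,1]$ be the unique embedding of MV-algebras, and let $\iota:A\to[0,1]^{\operatorname{Max}A}$, $a\mapsto\widehat a$, where $\widehat a(M)=\iota_M(a/M)$. For $X\subseteq A$ let $uX$ and $lX$ be the sets of upper and lower bounds of $X$ in $A$. A cut is a set $X\subseteq A$ with $X=luX$; it is a limit cut if $\bigwedge\{d(\widehat a,\widehat b):a\in X,\ b\in uX\}=0$ in $[0,1]^{\operatorname{Max}A}$. $A$ is limit cut complete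 if it is semisimple and every limit cut of $A$ has a supremum in $A$. -/

import Mathlib

universe u v

/-- MV-algebras `⟨A, ⊕, *, 0⟩`, in the standard axiomatization. -/
class MVAlgebra (A : Type u) where
  oplus : A → A → A
  neg : A → A
  zero : A
  oplus_assoc : ∀ a b c, oplus (oplus a b) c = oplus a (oplus b c)
  oplus_comm : ∀ a b, oplus a b = oplus b a
  oplus_zero : ∀ a, oplus a zero = a
  neg_neg_self : ∀ a, neg (neg a) = a
  oplus_neg_zero : ∀ a, oplus a (neg zero) = neg zero
  lukasiewicz : ∀ a b, oplus (neg (oplus (neg a) b)) b = oplus (neg (oplus (neg b) a)) a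

namespace MV

open MVAlgebra

section Basic

variable {A : Type u} [MVAlgebra A]

/-- The top element `1 = 0*`. -/
def one : A := neg zero

/-- The natural order: `a ≤ b` iff `a* ⊕ b = 1`. -/
def le (a b : A) : Prop := oplus (neg a) b = one

/-- Truncated difference `a ⊖ b = (a* ⊕ b)*`. -/
def sub (a b : A) : A := neg (oplus (neg a) b)

/-- Chang's distance `d(a, b) = (a ⊖ b) ⊕ (b ⊖ a)`. -/
def dist (a b : A) : A := oplus (sub a b) (sub b a)

/-- The interval `[a, b]` of `A`. -/
def interval (a b : A) : Set A := {x | le a x ∧ le x b}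

/-- The set `uX` of upper bounds of `X` in `A`. -/
def ub (X : Set A) : Set A := {b | ∀ a ∈ X, le a b}

/-- The set `lX` of lower bounds of `X` in `A`. -/
def lb (X : Set A) : Set A := {b | ∀ a ∈ X, le b a}

/-- `s` is the supremum of `X` in `A`. -/
def IsSup (X : Set A) (s : A) : Prop := s ∈ ub X ∧ ∀ t ∈ ub X, le s t

/-- A cut of `A` is a subset `X` with `X = luX`. -/
def IsCut (X : Set A) : Prop := X = lb (ub X)

theorem oplus_one (a : A) : oplus a one = one := oplus_neg_zero a

theorem one_oplus (a : A) : oplus one a = one := by rw [oplus_comm, oplus_one]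

theorem neg_one : neg (one : A) = zero := neg_neg_self _

theorem zero_oplus (a : A) : oplus zero a = a := by rw [oplus_comm, oplus_zero]

theorem neg_oplus_self (a : A) : oplus (neg a) a = one := by
  have h := lukasiewicz a one
  rw [oplus_one, neg_one, zero_oplus] at h
  exact h.symm

theorem sub_self (a : A) : sub a a = zero := by
  rw [sub, neg_oplus_self, neg_one]

theorem le_oplus_left (a b : A) : le a (oplus a b) := by
  rw [le, ← oplus_assoc, neg_oplus_self, one_oplus]

theorem le_oplus_right (a b : A) : le b (oplus a b) := by
  rw [oplus_comm]; exact le_oplus_left b a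

theorem sub_triangle (a b c : A) : le (sub a c) (oplus (sub a b) (sub b c)) := by
  let _i1 : Std.Associative (oplus : A → A → A) := ⟨oplus_assoc⟩
  let _i2 : Std.Commutative (oplus : A → A → A) := ⟨oplus_comm⟩
  unfold le sub
  rw [neg_neg_self]
  calc oplus (oplus (neg a) c) (oplus (neg (oplus (neg a) b)) (neg (oplus (neg b) c)))
      = oplus (oplus (neg (oplus (neg b) c)) c) (oplus (neg a) (neg (oplus (neg a) b))) := by
        ac_rfl
    _ = oplus (oplus (neg (oplus (neg c) b)) b) (oplus (neg a) (neg (oplus (neg a) b))) := by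
        rw [lukasiewicz]
    _ = oplus (neg (oplus (neg c) b)) (oplus (neg (oplus (neg a) b)) (oplus (neg a) b)) := by
        ac_rfl
    _ = one := by rw [neg_oplus_self, oplus_one]

theorem sub_oplus_le (a b c : A) : le (sub (oplus a c) (oplus b c)) (sub a b) := by
  let _i1 : Std.Associative (oplus : A → A → A) := ⟨oplus_assoc⟩
  let _i2 : Std.Commutative (oplus : A → A → A) := ⟨oplus_comm⟩
  unfold le sub
  rw [neg_neg_self]
  calc oplus (oplus (neg (oplus a c)) (oplus b c)) (neg (oplus (neg a) b))
      = oplus (oplus (neg (oplus (neg a) b)) b) (oplus c (neg (oplus a c))) := by ac_rfl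
    _ = oplus (oplus (neg (oplus (neg b) a)) a) (oplus c (neg (oplus a c))) := by
        rw [lukasiewicz]
    _ = oplus (neg (oplus (neg b) a)) (oplus (neg (oplus a c)) (oplus a c)) := by ac_rfl
    _ = one := by rw [neg_oplus_self, oplus_one]

theorem sub_neg_neg (a b : A) : sub (neg a) (neg b) = sub b a := by
  rw [sub, sub, neg_neg_self, oplus_comm]

end Basic

section Homs

variable {A : Type u} {B : Type v} [MVAlgebra A] [MVAlgebra B]

/-- Homomorphisms of MV-algebras. -/
def IsHom (f : A → B) : Prop :=
  f zero = zero ∧ (∀ a b, f (oplus a b) = oplus (f a) (f b)) ∧ ∀ a, f (neg a) = neg (f a)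

/-- Embeddings: injective homomorphisms. -/
def IsEmbedding (f : A → B) : Prop := IsHom f ∧ Function.Injective f

variable (A B) in
/-- `A` and `B` are isomorphic MV-algebras. -/
def Isomorphic : Prop := ∃ f : A → B, IsHom f ∧ Function.Bijective f

end Homs

/-- The standard MV-algebra `[0, 1]`: `x ⊕ y = min (1, x + y)`, `x* = 1 - x`. -/
noncomputable instance : MVAlgebra unitInterval where
  oplus x y := ⟨min 1 ((x : ℝ) + y), le_min zero_le_one (add_nonneg x.2.1 y.2.1), min_le_left _ _⟩
  neg x := ⟨1 - (x : ℝ), sub_nonneg.2 x.2.2, sub_le_self _ x.2.1⟩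
  zero := 0
  oplus_assoc := by
    rintro ⟨a, ha0, ha1⟩ ⟨b, hb0, hb1⟩ ⟨c, hc0, hc1⟩
    apply Subtype.ext
    simp only [min_def]
    split_ifs <;> linarith
  oplus_comm a b := by
    apply Subtype.ext
    simp only [add_comm]
  oplus_zero := by
    rintro ⟨a, ha0, ha1⟩
    apply Subtype.ext
    simp [ha1]
  neg_neg_self a := by
    apply Subtype.ext
    simp
  oplus_neg_zero := by
    rintro ⟨a, ha0, ha1⟩
    apply Subtype.ext
    simp [ha0]
  lukasiewicz := by
    rintro ⟨a, ha0, ha1⟩ ⟨b, hb0, hb1⟩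
    apply Subtype.ext
    simp only [min_def]
    split_ifs <;> linarith

/-- Direct products of MV-algebras, with pointwise operations. -/
instance {I : Type u} {B : I → Type v} [∀ i, MVAlgebra (B i)] : MVAlgebra (∀ i, B i) where
  oplus f g i := oplus (f i) (g i)
  neg f i := neg (f i)
  zero _ := zero
  oplus_assoc f g h := funext fun i => oplus_assoc (f i) (g i) (h i)
  oplus_comm f g := funext fun i => oplus_comm (f i) (g i)
  oplus_zero f := funext fun i => oplus_zero (f i)
  neg_neg_self f := funext fun i => neg_neg_self (f i)
  oplus_neg_zero f := funext fun i => oplus_neg_zero (f i)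
  lukasiewicz f g := funext fun i => lukasiewicz (f i) (g i)

/-- The underlying set `{0, 1/n, …, (n-1)/n, 1}` (for `n ≥ 1`) of the finite Łukasiewicz chain
with `n + 1` elements: those `x ∈ [0, 1]` for which `n x` is a natural number. -/
def LukChain (n : ℕ) : Type := {x : unitInterval // ∃ k : ℕ, (x : ℝ) * n = k}

/-- `LukChain n` is an MV-algebra with the operations inherited from `[0, 1]`. -/
noncomputable instance (n : ℕ) : MVAlgebra (LukChain n) where
  oplus x y := ⟨oplus x.1 y.1, by
    obtain ⟨x, k, hk⟩ := x
    obtain ⟨y, l, hl⟩ := y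
    change ∃ m : ℕ, min 1 ((x : ℝ) + y) * n = m
    rcases min_choice (1 : ℝ) ((x : ℝ) + y) with h | h
    · exact ⟨n, by rw [h, one_mul]⟩
    · exact ⟨k + l, by rw [h, add_mul, hk, hl]; push_cast; rfl⟩⟩
  neg x := ⟨neg x.1, by
    obtain ⟨x, k, hk⟩ := x
    have hkn : k ≤ n := by
      have : (k : ℝ) ≤ n := by
        rw [← hk]; exact mul_le_of_le_one_left (Nat.cast_nonneg n) x.2.2
      exact_mod_cast this
    change ∃ m : ℕ, (1 - (x : ℝ)) * n = m
    exact ⟨n - k, by rw [sub_mul, one_mul, hk, Nat.cast_sub hkn]⟩⟩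
  zero := ⟨zero, 0, by change ((0 : unitInterval) : ℝ) * n = _; simp⟩
  oplus_assoc x y z := Subtype.ext (oplus_assoc x.1 y.1 z.1)
  oplus_comm x y := Subtype.ext (oplus_comm x.1 y.1)
  oplus_zero x := Subtype.ext (oplus_zero x.1)
  neg_neg_self x := Subtype.ext (neg_neg_self x.1)
  oplus_neg_zero x := Subtype.ext (oplus_neg_zero x.1)
  lukasiewicz x y := Subtype.ext (lukasiewicz x.1 y.1)

/-- Ideals of an MV-algebra. -/
structure MVIdeal (A : Type u) [MVAlgebra A] where
  carrier : Set A
  zero_mem : zero ∈ carrier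
  oplus_mem : ∀ {a b}, a ∈ carrier → b ∈ carrier → oplus a b ∈ carrier
  mem_of_le : ∀ {a b}, le a b → b ∈ carrier → a ∈ carrier

namespace MVIdeal

variable {A : Type u} [MVAlgebra A]

def IsProper (I : MVIdeal A) : Prop := I.carrier ≠ Set.univ

/-- Maximal ideals: maximal among the proper ideals. -/
def IsMaximal (M : MVIdeal A) : Prop :=
  M.IsProper ∧ ∀ J : MVIdeal A, J.IsProper → M.carrier ⊆ J.carrier → J.carrier = M.carrier

/-- The congruence of an ideal: `a ~ b` iff `d(a, b) ∈ I`. -/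
def Rel (I : MVIdeal A) (a b : A) : Prop := dist a b ∈ I.carrier

theorem rel_iff (I : MVIdeal A) (a b : A) :
    I.Rel a b ↔ sub a b ∈ I.carrier ∧ sub b a ∈ I.carrier :=
  ⟨fun h => ⟨I.mem_of_le (le_oplus_left _ _) h, I.mem_of_le (le_oplus_right _ _) h⟩,
    fun h => I.oplus_mem h.1 h.2⟩

def setoid (I : MVIdeal A) : Setoid A where
  r := I.Rel
  iseqv :=
    { refl := fun a => (I.rel_iff a a).2 (by rw [sub_self]; exact ⟨I.zero_mem, I.zero_mem⟩)
      symm := fun {a b} h => (I.rel_iff b a).2 ((I.rel_iff a b).1 h).symm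
      trans := fun {a b c} h k => by
        obtain ⟨h1, h2⟩ := (I.rel_iff a b).1 h
        obtain ⟨k1, k2⟩ := (I.rel_iff b c).1 k
        exact (I.rel_iff a c).2 ⟨I.mem_of_le (sub_triangle a b c) (I.oplus_mem h1 k1),
          I.mem_of_le (sub_triangle c b a) (I.oplus_mem k2 h2)⟩ }

theorem rel_neg (I : MVIdeal A) {a b : A} (h : I.Rel a b) : I.Rel (neg a) (neg b) := by
  rw [rel_iff, sub_neg_neg, sub_neg_neg]
  exact ((I.rel_iff a b).1 h).symm

theorem rel_oplus_right (I : MVIdeal A) {a b : A} (c : A) (h : I.Rel a b) :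
    I.Rel (oplus a c) (oplus b c) :=
  (I.rel_iff _ _).2 ⟨I.mem_of_le (sub_oplus_le a b c) ((I.rel_iff a b).1 h).1,
    I.mem_of_le (sub_oplus_le b a c) ((I.rel_iff a b).1 h).2⟩

theorem rel_oplus (I : MVIdeal A) {a b c d : A} (h : I.Rel a b) (k : I.Rel c d) :
    I.Rel (oplus a c) (oplus b d) :=
  I.setoid.trans (I.rel_oplus_right c h) (by
    rw [oplus_comm b c, oplus_comm b d]
    exact I.rel_oplus_right b k)

/-- The quotient `A/I`. -/
def Quot (I : MVIdeal A) : Type u := Quotient I.setoid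

/-- The canonical projection `a ↦ a/I`. -/
def proj (I : MVIdeal A) (a : A) : I.Quot := Quotient.mk I.setoid a

instance (I : MVIdeal A) : MVAlgebra I.Quot where
  oplus := Quotient.map₂ oplus fun _ _ h _ _ k => I.rel_oplus h k
  neg := Quotient.map neg fun _ _ h => I.rel_neg h
  zero := I.proj zero
  oplus_assoc := by
    rintro ⟨a⟩ ⟨b⟩ ⟨c⟩
    exact congrArg I.proj (oplus_assoc a b c)
  oplus_comm := by
    rintro ⟨a⟩ ⟨b⟩
    exact congrArg I.proj (oplus_comm a b)
  oplus_zero := by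
    rintro ⟨a⟩
    exact congrArg I.proj (oplus_zero a)
  neg_neg_self := by
    rintro ⟨a⟩
    exact congrArg I.proj (neg_neg_self a)
  oplus_neg_zero := by
    rintro ⟨a⟩
    exact congrArg I.proj (oplus_neg_zero a)
  lukasiewicz := by
    rintro ⟨a⟩ ⟨b⟩
    exact congrArg I.proj (lukasiewicz a b)

end MVIdeal

section Spectrum

variable (A : Type u) [MVAlgebra A]

/-- `Max A`, the set of maximal ideals of `A`. -/
def MaxIdeal : Type u := {M : MVIdeal A // M.IsMaximal}

/-- `A` is simple: its only proper ideal is `{0}` (so `{0}` is a proper ideal). -/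
def IsSimple : Prop := ∀ I : MVIdeal A, I.IsProper ↔ I.carrier = {zero}

/-- `A` is totally ordered. -/
def IsMVChain : Prop := ∀ a b : A, le a b ∨ le b a

/-- `A` is complete: every subset has a supremum. -/
def IsComplete : Prop := ∀ S : Set A, ∃ s, IsSup S s

variable {A}

/-- `f` exhibits `A` as a subdirect product of the family `B`. -/
def IsSubdirect {I : Type u} {B : I → Type u} [∀ i, MVAlgebra (B i)] (f : A → ∀ i, B i) : Prop :=
  IsEmbedding f ∧ ∀ i, Function.Surjective fun a => f a i

variable (A) in
/-- `A` is semisimple: a subdirect product of simple MV-algebras. -/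
def IsSemisimple : Prop :=
  ∃ (I : Type u) (B : I → Type u) (_ : ∀ i, MVAlgebra (B i)) (f : A → ∀ i, B i),
    IsSubdirect f ∧ ∀ i, IsSimple (B i)

/-- `ι_M`, the embedding of `A/M` into `[0, 1]`. For every maximal ideal `M` such an embedding
exists and is unique. -/
noncomputable def iotaAt (M : MaxIdeal A) : M.1.Quot → unitInterval :=
  Classical.epsilon IsEmbedding

/-- `ι : A → [0, 1]^(Max A)`, `ι a = â` with `â(M) = ι_M(a/M)`. -/
noncomputable def iota (a : A) : MaxIdeal A → unitInterval := fun M => iotaAt M (M.1.proj a)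

/-- A limit cut is a cut `X` for which the infimum in `[0, 1]^(Max A)` of all distances
`d(â, b̂)`, with `a ∈ X` and `b ∈ uX`, is `0`. -/
def IsLimitCut (X : Set A) : Prop :=
  IsCut X ∧ IsGLB {δ : MaxIdeal A → unitInterval | ∃ a ∈ X, ∃ b ∈ ub X, δ = dist (iota a) (iota b)}
    zero

variable (A) in
/-- Limit cut complete: semisimple, and every limit cut has a supremum in the algebra. -/
def IsLimitCutComplete : Prop :=
  IsSemisimple A ∧ ∀ X : Set A, IsLimitCut X → ∃ s, IsSup X s

end Spectrum

section Density

variable {I : Type u}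

/-- Order density of `S` in `T`: between any two comparable elements of `T` lies one of `S`. -/
def OrderDense (S T : Set (I → unitInterval)) : Prop :=
  ∀ α ∈ T, ∀ β ∈ T, α < β → ∃ γ ∈ S, α ≤ γ ∧ γ ≤ β

/-- Density of `S` in `T` in the sense of order completions: every element of `T` is both a
supremum and an infimum, in `[0, 1]^I`, of elements of `S`. -/
def JoinMeetDense (S T : Set (I → unitInterval)) : Prop :=
  ∀ α ∈ T, (∃ X ⊆ S, IsLUB X α) ∧ ∃ Y ⊆ S, IsGLB Y α

/-- Density of `S` in `T` for the metric of uniform convergence. -/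
def UniformlyDense (S T : Set (I → unitInterval)) : Prop :=
  ∀ α ∈ T, ∀ ε : ℝ, 0 < ε → ∃ γ ∈ S, ∀ i, |(γ i : ℝ) - α i| ≤ ε

end Density

end MV

namespace MV

open MVAlgebra Filter Topology

/-! ### Order, cancellation and multiples in an MV-algebra. -/

section Arithmetic

variable {A : Type u} [MVAlgebra A]

/-! Limit cut completeness enters only through `IsLimitCutComplete.exists_between`: if `X` lies
below `Y` and their gap is arbitrarily small at each coordinate, the cut `lu X` is a limit cut and
its supremum separates `X` from `Y`.

For intervals, apply this to the elements of `[a, b]` below and above `α`. If they approximate `α`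
at each coordinate (`Approximates`), the separating element has image `α`. Each kind of density
yields such approximations by altering `α` at a single coordinate; uniform density also needs an
element of `A` that is `1` at that coordinate and `0` elsewhere, to turn approximation into
one-sided approximation.

For quotients, a quotient by a maximal ideal is archimedean, hence a chain. Counting multiples of
small elements embeds it in `[0, 1]` (Hölder). With a minimal nonzero element it is a finite
Łukasiewicz chain. Otherwise its values are arbitrarily fine, so any real `r` in `[0, 1]` can be
enclosed at `M` by nested intervals of `A`; truncation makes their widths tend to `0` at all
coordinates, and separation produces an element with value `r` at `M`. Thus the embedding is onto.
-/

theorem le_self (a : A) : le a a := neg_oplus_self a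

theorem le_one (a : A) : le a one := oplus_one _

theorem zero_le (a : A) : le zero a := one_oplus a

theorem sub_le_iff {a b c : A} : le (sub a b) c ↔ le a (oplus b c) := by
  rw [le, le, sub, neg_neg_self, oplus_assoc]

theorem sub_eq_zero_iff {a b : A} : sub a b = zero ↔ le a b := by
  constructor
  · intro h
    rw [le, ← neg_neg_self (oplus (neg a) b)]
    exact congrArg neg h
  · intro h
    rw [sub, h, neg_one]

theorem sub_oplus_cancel {a b : A} (h : le b a) : oplus (sub a b) b = a := by
  rw [sub, lukasiewicz, h, neg_one, zero_oplus]

theorem le_antisymm {a b : A} (h : le a b) (k : le b a) : a = b := by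
  have e := sub_oplus_cancel k
  rw [sub_eq_zero_iff.2 h, zero_oplus] at e
  exact e.symm

theorem le_trans {a b c : A} (h : le a b) (k : le b c) : le a c := by
  rw [← sub_oplus_cancel k, ← sub_oplus_cancel h, ← oplus_assoc]
  exact le_oplus_right _ _

theorem oplus_le_oplus_right {a b : A} (h : le a b) (c : A) : le (oplus a c) (oplus b c) := by
  rw [← sub_oplus_cancel h, oplus_assoc]
  exact le_oplus_right _ _

theorem oplus_le_oplus {a b c d : A} (h : le a b) (k : le c d) :
    le (oplus a c) (oplus b d) := by
  refine le_trans (oplus_le_oplus_right h c) ?_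
  rw [oplus_comm b, oplus_comm b]
  exact oplus_le_oplus_right k b

theorem oplus_sub_cancel {x y : A} (h : le x (neg y)) : sub (oplus x y) y = x := by
  have e := lukasiewicz (neg x) y
  rw [neg_neg_self, oplus_comm (neg y), show oplus (neg x) (neg y) = one from h, neg_one,
    zero_oplus] at e
  rw [sub, e, neg_neg_self]

/-- Cancellation is valid because `x ≤ y*` means that `x ⊕ y` is not truncated. -/
theorem le_of_oplus_le_oplus {x y a : A} (h : le x (neg y))
    (k : le (oplus x y) (oplus a y)) : le x a := by
  rw [← oplus_sub_cancel h, sub_le_iff, oplus_comm y a]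
  exact k

/-- Only the part `q ∧ p*` of `q` contributes to `p ⊕ q`; the excess `q ⊖ p*` completes that part to
`q` and is therefore absorbed. -/
theorem oplus_oplus_inter (p q : A) :
    oplus (oplus p q) (sub q (neg p)) = oplus p q := by
  have h1 : sub (oplus p q) p = sub q (sub q (neg p)) := by
    have e := lukasiewicz (neg q) p
    rw [neg_neg_self] at e
    rw [sub, sub, sub, oplus_comm p q, e, oplus_comm (neg p), oplus_comm _ (neg q)]
  have h2 : le (sub q (neg p)) q := sub_le_iff.2 (le_oplus_right _ _)
  calc oplus (oplus p q) (sub q (neg p))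
      = oplus (oplus (sub (oplus p q) p) p) (sub q (neg p)) := by
        rw [sub_oplus_cancel (le_oplus_left p q)]
    _ = oplus p (oplus (sub q (sub q (neg p))) (sub q (neg p))) := by
        rw [h1, oplus_comm _ p, oplus_assoc]
    _ = oplus p q := by rw [sub_oplus_cancel h2]

/-- Disjointness of `a ⊖ b` and `b ⊖ a`, in a form that passes to multiples by iteration. -/
theorem sub_sub_comm_self (a b : A) : sub (sub a b) (sub b a) = sub a b := by
  have e := oplus_oplus_inter (neg a) b
  rw [neg_neg_self] at e
  rw [sub, sub, neg_neg_self]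
  exact congrArg neg e

theorem sub_sub (a b c : A) : sub (sub a b) c = sub a (oplus b c) := by
  rw [sub, sub, sub, neg_neg_self, oplus_assoc]

/-- The `n`-fold sum `x ⊕ ⋯ ⊕ x`. -/
def nmul : ℕ → A → A
  | 0, _ => zero
  | n + 1, x => oplus (nmul n x) x

theorem nmul_succ (n : ℕ) (x : A) : nmul (n + 1) x = oplus (nmul n x) x := rfl

theorem nmul_one_left (x : A) : nmul 1 x = x := zero_oplus x

theorem nmul_add (m n : ℕ) (x : A) : nmul (m + n) x = oplus (nmul m x) (nmul n x) := by
  induction n with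
  | zero => exact (oplus_zero _).symm
  | succ n ih => rw [← Nat.add_assoc, nmul_succ, nmul_succ, ih, oplus_assoc]

theorem nmul_mono_left {m n : ℕ} (h : m ≤ n) (x : A) : le (nmul m x) (nmul n x) := by
  obtain ⟨k, rfl⟩ := Nat.exists_eq_add_of_le h
  rw [nmul_add]
  exact le_oplus_left _ _

theorem nmul_mono_right {x y : A} (h : le x y) (n : ℕ) : le (nmul n x) (nmul n y) := by
  induction n with
  | zero => exact le_self _
  | succ n ih => exact oplus_le_oplus ih h

theorem sub_nmul_eq_self {x y : A} (h : sub x y = x) (n : ℕ) : sub x (nmul n y) = x := by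
  induction n with
  | zero => rw [sub, nmul, oplus_zero, neg_neg_self]
  | succ n ih => rw [nmul_succ, ← sub_sub, ih, h]

theorem eq_of_dist_eq_zero {a b : A} (h : dist a b = zero) : a = b := by
  apply le_antisymm <;> rw [← sub_eq_zero_iff] <;> apply le_antisymm _ (zero_le _) <;> rw [← h]
  · exact le_oplus_left _ _
  · exact le_oplus_right _ _

theorem dist_self (a : A) : dist a a = zero := by
  rw [dist, sub_self, oplus_zero]

end Arithmetic

/-! ### Homomorphisms and embeddings. -/

section Homs

variable {A : Type u} {B : Type v} [MVAlgebra A] [MVAlgebra B] {f : A → B}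

theorem IsHom.map_one (hf : IsHom f) : f one = one := by
  rw [one, hf.2.2, hf.1, one]

theorem IsHom.map_sub (hf : IsHom f) (a b : A) : f (sub a b) = sub (f a) (f b) := by
  rw [sub, hf.2.2, hf.2.1, hf.2.2, sub]

theorem IsHom.map_dist (hf : IsHom f) (a b : A) : f (dist a b) = dist (f a) (f b) := by
  rw [dist, hf.2.1, hf.map_sub, hf.map_sub, dist]

theorem IsHom.map_nmul (hf : IsHom f) (n : ℕ) (a : A) : f (nmul n a) = nmul n (f a) := by
  induction n with
  | zero => exact hf.1
  | succ n ih => rw [nmul_succ, hf.2.1, ih, nmul_succ]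

theorem IsHom.map_le (hf : IsHom f) {a b : A} (h : le a b) : le (f a) (f b) := by
  rw [le, ← hf.2.2, ← hf.2.1, h, hf.map_one]

theorem IsEmbedding.le_iff (hf : IsEmbedding f) {a b : A} : le (f a) (f b) ↔ le a b := by
  refine ⟨fun h => hf.2 ?_, hf.1.map_le⟩
  rw [hf.1.2.1, hf.1.2.2, hf.1.map_one]
  exact h

theorem IsEmbedding.comp {D : Type*} [MVAlgebra D] {g : B → D} (hg : IsEmbedding g)
    (hf : IsEmbedding f) : IsEmbedding (g ∘ f) :=
  ⟨⟨by rw [Function.comp_apply, hf.1.1, hg.1.1],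
    fun a b => by simp only [Function.comp_apply, hf.1.2.1, hg.1.2.1],
    fun a => by simp only [Function.comp_apply, hf.1.2.2, hg.1.2.2]⟩, hg.2.comp hf.2⟩

theorem IsComplete.of_isomorphic (hB : IsComplete B) (h : Isomorphic A B) : IsComplete A := by
  obtain ⟨f, hf, hbij⟩ := h
  have le_iff := fun {a b : A} => IsEmbedding.le_iff (a := a) (b := b) ⟨hf, hbij.1⟩
  intro S
  obtain ⟨t, ht⟩ := hB (f '' S)
  obtain ⟨s, rfl⟩ := hbij.2 t
  refine ⟨s, fun a ha => le_iff.1 (ht.1 _ ⟨a, ha, rfl⟩), fun b hb => le_iff.1 (ht.2 _ ?_)⟩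
  rintro _ ⟨a, ha, rfl⟩
  exact le_iff.2 (hb a ha)

end Homs

/-! ### The standard algebra and the finite chains. -/

section UnitInterval

theorem coe_oplus (x y : unitInterval) : ((oplus x y : unitInterval) : ℝ) = min 1 ((x : ℝ) + y) :=
  rfl

theorem coe_neg (x : unitInterval) : ((neg x : unitInterval) : ℝ) = 1 - x := rfl

theorem coe_zero : ((zero : unitInterval) : ℝ) = 0 := rfl

theorem coe_one : ((one : unitInterval) : ℝ) = 1 := sub_zero 1

theorem coe_sub (x y : unitInterval) : ((sub x y : unitInterval) : ℝ) = max 0 ((x : ℝ) - y) := by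
  rw [sub, coe_neg, coe_oplus, coe_neg]
  rcases _root_.le_total (x : ℝ) y with h | h
  · rw [min_eq_left (by linarith), max_eq_left (by linarith)]; ring
  · rw [min_eq_right (by linarith), max_eq_right (by linarith)]; ring

theorem coe_dist_of_le {x y : unitInterval} (h : x ≤ y) :
    ((dist x y : unitInterval) : ℝ) = y - x := by
  have h' : (x : ℝ) ≤ y := h
  rw [dist, coe_oplus, coe_sub, coe_sub, max_eq_left (by linarith), max_eq_right (by linarith),
    zero_add, min_eq_right (by linarith [x.2.1, y.2.2])]

theorem coe_nmul (n : ℕ) (x : unitInterval) :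
    ((nmul n x : unitInterval) : ℝ) = min 1 (n * (x : ℝ)) := by
  induction n with
  | zero => rw [nmul, coe_zero]; simp
  | succ n ih =>
    rw [nmul_succ, coe_oplus, ih]
    push_cast
    have := x.2.1
    rcases _root_.le_total 1 ((n : ℝ) * x) with h | h
    · rw [min_eq_left h, min_eq_left (by linarith), min_eq_left (by linarith)]
    · rw [min_eq_right h]; congr 1; ring

theorem le_iff_le {x y : unitInterval} : le x y ↔ x ≤ y := by
  rw [← sub_eq_zero_iff, ← Subtype.coe_inj, coe_sub, coe_zero, max_eq_left_iff, sub_nonpos]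
  rfl

theorem isComplete_unitInterval : IsComplete unitInterval := fun S =>
  ⟨sSup S, fun _ ha => le_iff_le.2 (le_sSup ha), fun _ hb =>
    le_iff_le.2 (sSup_le fun a ha => le_iff_le.1 (hb a ha))⟩

/-- The inclusion of the finite Łukasiewicz chain in `[0, 1]`. -/
def LukChain.val {n : ℕ} (x : LukChain n) : unitInterval := Subtype.val x

theorem LukChain.isEmbedding_val (n : ℕ) : IsEmbedding (LukChain.val (n := n)) :=
  ⟨⟨rfl, fun _ _ => rfl, fun _ => rfl⟩, Subtype.val_injective⟩

theorem isComplete_lukChain {n : ℕ} (hn : 1 ≤ n) : IsComplete (LukChain n) := by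
  intro S
  have hn' : (0 : ℝ) < n := by exact_mod_cast hn
  rcases S.eq_empty_or_nonempty with rfl | ⟨x₀, hx₀⟩
  · exact ⟨zero, fun a ha => ha.elim, fun b _ => zero_le b⟩
  have hfin : Finite (LukChain n) := by
    choose k hk using fun x : LukChain n => x.2
    refine Finite.of_injective
      (fun x => (⟨k x, ?_⟩ : Set.Iic n)) fun x y h => ?_
    · have : (k x : ℝ) ≤ n := by
        rw [← hk]; exact mul_le_of_le_one_left hn'.le x.1.2.2
      exact_mod_cast this
    · have h' : k x = k y := congrArg Subtype.val h
      refine Subtype.ext (Subtype.ext (mul_right_cancel₀ hn'.ne' ?_))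
      rw [hk, hk, h']
  obtain ⟨s, hs, hmax⟩ := Set.exists_max_image S LukChain.val (Set.toFinite S) ⟨x₀, hx₀⟩
  exact ⟨s, fun a ha => (LukChain.isEmbedding_val n).le_iff.1 (le_iff_le.2 (hmax a ha)),
    fun b hb => hb s hs⟩

end UnitInterval

/-! ### Archimedean MV-algebras and Hölder's theorem. -/

section Archimedean

variable {C : Type u} [MVAlgebra C]

variable (C) in
/-- Every nonzero element has a multiple equal to `1`. -/
def IsArch : Prop := ∀ x : C, x ≠ zero → ∃ n, nmul n x = one

/-- Subtracting multiples of `b ⊖ a` never changes `a ⊖ b`; if `b ⊖ a` is nonzero, some multiple is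
`1`, which forces `a ⊖ b = 0`. -/
theorem IsArch.isMVChain (hC : IsArch C) : IsMVChain C := by
  intro a b
  by_contra! h
  have hb : sub b a ≠ zero := fun e => h.2 (sub_eq_zero_iff.1 e)
  obtain ⟨n, hn⟩ := hC _ hb
  have e := sub_nmul_eq_self (sub_sub_comm_self a b) n
  rw [hn, sub_eq_zero_iff.2 (le_one _)] at e
  exact h.1 (sub_eq_zero_iff.1 e.symm)

/-- The least `n` with `x ≤ n u`. -/
noncomputable def count (u x : C) : ℕ := sInf {n | le x (nmul n u)}

theorem count_le {u x : C} {n : ℕ} (h : le x (nmul n u)) : count u x ≤ n := Nat.sInf_le h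

theorem IsArch.le_nmul_count (hC : IsArch C) {u : C} (hu : u ≠ zero) (x : C) :
    le x (nmul (count u x) u) := by
  obtain ⟨n, hn⟩ := hC u hu
  refine Nat.sInf_mem (s := {n | le x (nmul n u)}) ⟨n, ?_⟩
  rw [Set.mem_ofPred_eq, hn]
  exact le_one x

theorem IsArch.count_mono (hC : IsArch C) {u : C} (hu : u ≠ zero) {x y : C} (h : le x y) :
    count u x ≤ count u y :=
  count_le (le_trans h (hC.le_nmul_count hu y))

theorem IsArch.count_oplus_le (hC : IsArch C) {u : C} (hu : u ≠ zero) (x y : C) :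
    count u (oplus x y) ≤ count u x + count u y := by
  apply count_le
  rw [nmul_add]
  exact oplus_le_oplus (hC.le_nmul_count hu x) (hC.le_nmul_count hu y)

/-- With counts `p + 1` and `q + 1`, a larger defect would give `x ⊕ y ≤ pu ⊕ qu ≤ pu ⊕ y`, and
cancelling `y` contradicts the minimality of `p + 1`. -/
theorem IsArch.count_add_count_le (hC : IsArch C) {u : C} (hu : u ≠ zero) {x y : C}
    (h : le x (neg y)) : count u x + count u y ≤ count u (oplus x y) + 1 := by
  have hx := hC.count_mono hu (le_oplus_left x y)
  have hy := hC.count_mono hu (le_oplus_right x y)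
  by_contra! hlt
  -- A zero count is excluded by monotonicity: the other count alone is at most that of `x ⊕ y`.
  obtain ⟨p, hp⟩ : ∃ p, count u x = p + 1 := ⟨count u x - 1, by omega⟩
  obtain ⟨q, hq⟩ : ∃ q, count u y = q + 1 := ⟨count u y - 1, by omega⟩
  have hxp : ¬ le x (nmul p u) := fun e => by have := count_le e; omega
  have hyq : ¬ le y (nmul q u) := fun e => by have := count_le e; omega
  refine hxp (le_of_oplus_le_oplus h (le_trans (hC.le_nmul_count hu _)
    (le_trans (nmul_mono_left (show _ ≤ p + q by omega) u) ?_)))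
  rw [nmul_add]
  exact oplus_le_oplus (le_self _) ((hC.isMVChain _ _).resolve_left hyq)

theorem IsArch.count_one_pos (hC : IsArch C) (h01 : (zero : C) ≠ one) {u : C} (hu : u ≠ zero) :
    0 < count u one := by
  rw [Nat.pos_iff_ne_zero]
  intro h
  have e := hC.le_nmul_count hu one
  rw [h] at e
  exact h01 (le_antisymm (zero_le _) e)

/-- There are elements whose multiples reach `1` arbitrarily late. -/
def HasSmall (C : Type u) [MVAlgebra C] : Prop := ∀ N : ℕ, ∃ v : C, v ≠ zero ∧ N < count v one

/-- The smaller of the two pieces `v` and `u ⊖ v` fits twice into `u`. -/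
theorem IsArch.exists_half (hC : IsArch C) {u : C}
    (h : ∃ v, v ≠ zero ∧ le v u ∧ v ≠ u) : ∃ w, w ≠ zero ∧ le (oplus w w) u ∧ w ≠ u := by
  obtain ⟨v, hv0, hvu, hne⟩ := h
  have e := sub_oplus_cancel hvu
  rcases hC.isMVChain v (sub u v) with k | k
  · refine ⟨v, hv0, ?_, hne⟩
    have := oplus_le_oplus_right k v
    rwa [e] at this
  · refine ⟨sub u v, fun h0 => hne (le_antisymm hvu (sub_eq_zero_iff.1 h0)), ?_, fun h => ?_⟩
    · have := oplus_le_oplus (le_self (sub u v)) k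
      rwa [e] at this
    · rw [h] at k
      exact hne (le_antisymm hvu k)

/-- Passing to a half raises the count of `1` by at least one: among the copies of `v`, one pair can
be replaced by a single `u`. -/
theorem IsArch.hasSmall (hC : IsArch C) (h01 : (zero : C) ≠ one)
    (h : ∀ u : C, u ≠ zero → ∃ v, v ≠ zero ∧ le v u ∧ v ≠ u) : HasSmall C := by
  intro N
  induction N with
  | zero => exact ⟨one, h01.symm, hC.count_one_pos h01 h01.symm⟩
  | succ N ih =>
    obtain ⟨u, hu, hN⟩ := ih
    obtain ⟨v, hv, hvu, hne⟩ := hC.exists_half (h u hu)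
    refine ⟨v, hv, ?_⟩
    have h1 := hC.le_nmul_count hv one
    obtain ⟨n, hn⟩ : ∃ n, count v one = n := ⟨_, rfl⟩
    have hle : le v u := le_trans (le_oplus_left v v) hvu
    rw [hn] at h1 ⊢
    match n, hn, h1 with
    | 0, hn, _ => exact absurd hn (hC.count_one_pos h01 hv).ne'
    | 1, _, h1 =>
      rw [nmul_one_left] at h1
      exact absurd (le_antisymm hle (le_trans (le_one u) h1)) hne
    | n + 2, _, h1 =>
      have : count u one ≤ n + 1 := by
        refine count_le (le_trans h1 ?_)
        rw [nmul_succ, nmul_succ, oplus_assoc, nmul_succ]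
        exact oplus_le_oplus (nmul_mono_right hle n) hvu
      omega

theorem IsArch.isEmbedding_of_additive (hC : IsArch C) {φ : C → unitInterval}
    (h1 : (φ one : ℝ) = 1)
    (hadd : ∀ x y, le x (neg y) → (φ (oplus x y) : ℝ) = φ x + φ y) : IsEmbedding φ := by
  have hneg : ∀ x, (φ (neg x) : ℝ) = 1 - φ x := fun x => by
    have := hadd (neg x) x (le_self _)
    rw [neg_oplus_self, h1] at this
    linarith
  have hom : IsHom φ := by
    refine ⟨Subtype.ext ?_, fun x y => Subtype.ext ?_, fun x => Subtype.ext ?_⟩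
    · rw [← neg_one, hneg, h1, coe_zero, _root_.sub_self]
    · rw [coe_oplus]
      rcases hC.isMVChain x (neg y) with h | h
      · rw [hadd x y h, min_eq_right]
        rw [← hadd x y h]
        exact (φ _).2.2
      · have h' : oplus x y = one := by
          rw [← neg_neg_self y, oplus_comm]
          exact h
        rw [h', h1, min_eq_left]
        have k : le (neg x) y := by rwa [le, neg_neg_self]
        -- The truncated case: splitting `y` as `(y ⊖ x*) ⊕ x*`, an untruncated sum, shows `φ y ≥ 1
        -- - φ x`.
        have e := hadd (sub y (neg x)) (neg x) (sub_le_iff.2 (by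
          rw [neg_neg_self, neg_oplus_self]; exact le_one y))
        rw [sub_oplus_cancel k, hneg] at e
        linarith [(φ (sub y (neg x))).2.1]
    · rw [hneg, coe_neg]
  refine ⟨hom, fun x y hxy => eq_of_dist_eq_zero ?_⟩
  by_contra hne
  -- A nonzero distance has a multiple equal to `1`, while `φ` kills the distance.
  obtain ⟨n, hn⟩ := hC _ hne
  have e := congrArg φ hn
  rw [hom.map_nmul, hom.map_dist, hxy, dist_self, ← hom.1, ← hom.map_nmul] at e
  have e0 : (φ (nmul n zero) : ℝ) = 1 := by rw [e, h1]
  rw [hom.map_nmul, hom.1, coe_nmul, coe_zero, mul_zero, min_eq_right zero_le_one] at e0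
  exact zero_ne_one e0

/-- The ratios of counts, relative to ever smaller units, are additive up to `1 / count (w k) one`,
which tends to `0`. A limit along an ultrafilter exists for all `x` at once by compactness, and is
exactly additive. -/
theorem IsArch.exists_isEmbedding_of_hasSmall (hC : IsArch C) (h01 : (zero : C) ≠ one)
    (hs : HasSmall C) : ∃ φ : C → unitInterval, IsEmbedding φ := by
  choose w hw0 hw using hs
  have hpos : ∀ k, (0 : ℝ) < count (w k) one := fun k => by
    exact_mod_cast hC.count_one_pos h01 (hw0 k)
  let ψ : ℕ → C → ℝ := fun k x => count (w k) x / count (w k) one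
  have hmem : ∀ x k, ψ k x ∈ Set.Icc (0 : ℝ) 1 := fun x k =>
    ⟨by positivity, (div_le_one (hpos k)).2 (by exact_mod_cast hC.count_mono (hw0 k) (le_one x))⟩
  have hlim : ∀ x, ∃ l : unitInterval,
      Tendsto (fun k => ψ k x) (hyperfilter ℕ : Filter ℕ) (𝓝 (l : ℝ)) := by
    intro x
    obtain ⟨l, hl, hle⟩ := (isCompact_Icc (a := (0 : ℝ)) (b := 1)).ultrafilter_le_nhds
      ((hyperfilter ℕ).map fun k => ψ k x)
      (le_principal_iff.2 (Filter.mem_map.2 (univ_mem' (hmem x))))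
    exact ⟨⟨l, hl⟩, hle⟩
  choose φ hφ using hlim
  have hinv : Tendsto (fun k => 1 / (count (w k) (one : C) : ℝ)) (hyperfilter ℕ : Filter ℕ)
      (𝓝 0) := by
    have : Tendsto (fun k => 1 / (count (w k) (one : C) : ℝ)) atTop (𝓝 0) := by
      refine squeeze_zero' (Eventually.of_forall fun k => by positivity) ?_
        tendsto_one_div_add_atTop_nhds_zero_nat
      refine Eventually.of_forall fun k => one_div_le_one_div_of_le (by positivity) ?_
      exact_mod_cast hw k
    exact this.mono_left (hyperfilter_le_cofinite.trans Nat.cofinite_eq_atTop.le)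
  refine ⟨φ, hC.isEmbedding_of_additive ?_ fun x y hxy => _root_.le_antisymm ?_ ?_⟩
  · refine tendsto_nhds_unique (hφ one) ?_
    have : (fun k => ψ k one) = fun _ => 1 := funext fun k => div_self (hpos k).ne'
    rw [this]
    exact tendsto_const_nhds
  · refine le_of_tendsto_of_tendsto' (hφ _) ((hφ x).add (hφ y)) fun k => ?_
    change _ / _ ≤ _ / _ + _ / _
    rw [← add_div]
    gcongr
    exact_mod_cast hC.count_oplus_le (hw0 k) x y
  · have := (hφ (oplus x y)).add hinv
    rw [add_zero] at this
    refine le_of_tendsto_of_tendsto' ((hφ x).add (hφ y)) this fun k => ?_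
    change _ / _ + _ / _ ≤ _ / _ + _ / _
    rw [← add_div, ← add_div]
    refine div_le_div_of_nonneg_right ?_ (hpos k).le
    exact_mod_cast hC.count_add_count_le (hw0 k) hxy

/-- The minimal element `u` is a unit of measure: every element is an exact multiple of it, so
normalised counts are the isomorphism. -/
theorem IsArch.isomorphic_lukChain (hC : IsArch C) (h01 : (zero : C) ≠ one) {u : C}
    (hu : u ≠ zero) (hmin : ∀ v, v ≠ zero → le v u → v = u) :
    ∃ n : ℕ, 1 ≤ n ∧ Isomorphic C (LukChain n) := by
  set N := count u one with hN
  have hNpos : 0 < N := hC.count_one_pos h01 hu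
  have hN1 : nmul N u = one := le_antisymm (le_one _) (hC.le_nmul_count hu one)
  have hmul : ∀ x, nmul (count u x) u = x := by
    intro x
    refine le_antisymm ?_ (hC.le_nmul_count hu x)
    obtain ⟨n, hn⟩ : ∃ n, count u x = n := ⟨_, rfl⟩
    rw [hn]
    cases n with
    | zero => exact zero_le x
    | succ n =>
      have hnot : ¬ le x (nmul n u) := fun e => by have := count_le e; omega
      have hle : le (nmul n u) x := (hC.isMVChain _ _).resolve_left hnot
      have hne : sub x (nmul n u) ≠ zero := fun e => hnot (sub_eq_zero_iff.1 e)
      -- The remainder is nonzero, so by minimality it is at least `u`.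
      have huv : le u (sub x (nmul n u)) := by
        rcases hC.isMVChain u (sub x (nmul n u)) with h | h
        · exact h
        · rw [hmin _ hne h]; exact le_self u
      have := oplus_le_oplus_right huv (nmul n u)
      rwa [sub_oplus_cancel hle, oplus_comm] at this
  have hcount : ∀ k ≤ N, count u (nmul k u) = k := by
    intro k hk
    refine _root_.le_antisymm (count_le (le_self _)) ?_
    -- A shorter expression for `ku`, completed by `N - k` copies of `u`, would reach `1` before
    -- `N`.
    have h1 : le one (nmul (count u (nmul k u) + (N - k)) u) := by
      rw [nmul_add, hmul, ← nmul_add, Nat.add_sub_cancel' hk, hN1]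
      exact le_self _
    have := count_le h1
    omega
  have hleN : ∀ x, count u x ≤ N := fun x => hC.count_mono hu (le_one x)
  have hNR : (0 : ℝ) < N := by exact_mod_cast hNpos
  have hadd : ∀ x y, count u (oplus x y) = min N (count u x + count u y) := by
    intro x y
    rcases _root_.le_total (count u x + count u y) N with h | h
    · rw [min_eq_right h, ← hcount _ h, nmul_add, hmul, hmul]
    · rw [min_eq_left h]
      refine _root_.le_antisymm (hleN _) (count_le ?_)
      have := nmul_mono_left h u
      rwa [nmul_add, hN1, hmul, hmul, ← hmul (oplus x y)] at this
  have hneg : ∀ x, count u (neg x) = N - count u x := by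
    intro x
    have h1 := hadd (neg x) x
    rw [neg_oplus_self, ← hN] at h1
    have h2 : le (neg x) (nmul (N - count u x) u) := by
      have e : oplus x (nmul (N - count u x) u) = one := by
        have e' := nmul_add (count u x) (N - count u x) u
        rwa [Nat.add_sub_cancel' (hleN x), hN1, hmul, eq_comm] at e'
      rw [le, neg_neg_self, e]
    have h3 := count_le h2
    omega
  have hmem : ∀ x, ((count u x : ℝ) / N) ∈ Set.Icc (0 : ℝ) 1 := fun x =>
    ⟨by positivity, (div_le_one hNR).2 (by exact_mod_cast hleN x)⟩
  refine ⟨N, hNpos, fun x => ⟨⟨(count u x : ℝ) / N, hmem x⟩, count u x,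
    div_mul_cancel₀ _ hNR.ne'⟩, ⟨?_, fun x y => ?_, fun x => ?_⟩, fun x y hxy => ?_, ?_⟩
  · apply Subtype.ext
    apply Subtype.ext
    change (count u zero : ℝ) / N = 0
    rw [show (zero : C) = nmul 0 u from rfl, hcount 0 (Nat.zero_le _)]
    simp
  · apply Subtype.ext
    apply Subtype.ext
    change (count u (oplus x y) : ℝ) / N = min 1 (_ / _ + _ / _)
    rw [hadd, ← add_div, Nat.cast_min, ← min_div_div_right hNR.le, div_self hNR.ne']
    push_cast
    rfl
  · apply Subtype.ext
    apply Subtype.ext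
    change (count u (neg x) : ℝ) / N = 1 - _ / _
    rw [hneg, Nat.cast_sub (hleN x), sub_div, div_self hNR.ne']
  · have h : (count u x : ℝ) / N = count u y / N :=
      congrArg (fun z : LukChain N => (z.1 : ℝ)) hxy
    have h' : (count u x : ℝ) = count u y := by
      field_simp at h
      exact h
    rw [← hmul x, ← hmul y, Nat.cast_inj.1 h']
  · rintro ⟨z, k, hk⟩
    have hkN : k ≤ N := by
      have : (k : ℝ) ≤ N := by rw [← hk]; exact mul_le_of_le_one_left hNR.le z.2.2
      exact_mod_cast this
    refine ⟨nmul k u, Subtype.ext (Subtype.ext ?_)⟩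
    change (count u (nmul k u) : ℝ) / N = z
    rw [hcount k hkN, ← hk, mul_div_cancel_right₀ _ hNR.ne']

theorem IsArch.hasSmall_or_isomorphic (hC : IsArch C) (h01 : (zero : C) ≠ one) :
    HasSmall C ∨ ∃ n : ℕ, 1 ≤ n ∧ Isomorphic C (LukChain n) := by
  by_cases h : ∀ u : C, u ≠ zero → ∃ v, v ≠ zero ∧ le v u ∧ v ≠ u
  · exact Or.inl (hC.hasSmall h01 h)
  · push Not at h
    obtain ⟨u, hu, hmin⟩ := h
    exact Or.inr (hC.isomorphic_lukChain h01 hu hmin)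

/-- Hölder's theorem for archimedean MV-algebras. -/
theorem IsArch.exists_isEmbedding (hC : IsArch C) (h01 : (zero : C) ≠ one) :
    ∃ φ : C → unitInterval, IsEmbedding φ := by
  rcases hC.hasSmall_or_isomorphic h01 with h | ⟨n, _, f, hf, hbij⟩
  · exact hC.exists_isEmbedding_of_hasSmall h01 h
  · exact ⟨_, (LukChain.isEmbedding_val n).comp ⟨hf, hbij.1⟩⟩

end Archimedean

end MV
namespace MV

open MVAlgebra

/-! ### Quotients by maximal ideals and semisimplicity. -/

section Quotients

variable {A : Type u} [MVAlgebra A]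

theorem MVIdeal.isHom_proj (I : MVIdeal A) : IsHom I.proj :=
  ⟨rfl, fun _ _ => rfl, fun _ => rfl⟩

theorem MVIdeal.proj_surjective (I : MVIdeal A) : Function.Surjective I.proj :=
  Quotient.mk_surjective

theorem MVIdeal.proj_eq_proj_iff (I : MVIdeal A) {a b : A} :
    I.proj a = I.proj b ↔ dist a b ∈ I.carrier :=
  Quotient.eq (r := I.setoid)

theorem dist_zero (a : A) : dist a zero = a := by
  rw [dist, sub_eq_zero_iff.2 (zero_le a), oplus_zero, sub, oplus_zero, neg_neg_self]

theorem MVIdeal.proj_eq_zero_iff (I : MVIdeal A) {a : A} :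
    I.proj a = zero ↔ a ∈ I.carrier := by
  rw [← I.isHom_proj.1, I.proj_eq_proj_iff, dist_zero]

theorem MVIdeal.eq_univ_of_one_mem (I : MVIdeal A) (h : one ∈ I.carrier) :
    I.carrier = Set.univ :=
  Set.eq_univ_of_forall fun x => I.mem_of_le (le_one x) h

theorem MVIdeal.IsProper.zero_ne_one {I : MVIdeal A} (hI : I.IsProper) :
    (zero : I.Quot) ≠ one := by
  intro h
  rw [← I.isHom_proj.map_one, eq_comm, I.proj_eq_zero_iff] at h
  exact hI (I.eq_univ_of_one_mem h)

/-- The ideal generated by the ideal `I` and the element `x`. -/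
def MVIdeal.adjoin (I : MVIdeal A) (x : A) : MVIdeal A where
  carrier := {y | ∃ m ∈ I.carrier, ∃ n, le y (oplus m (nmul n x))}
  zero_mem := ⟨zero, I.zero_mem, 0, zero_le _⟩
  oplus_mem := by
    rintro a b ⟨m, hm, n, h⟩ ⟨m', hm', n', h'⟩
    refine ⟨oplus m m', I.oplus_mem hm hm', n + n', ?_⟩
    have e : oplus (oplus m (nmul n x)) (oplus m' (nmul n' x)) =
        oplus (oplus m m') (nmul (n + n') x) := by
      let _i1 : Std.Associative (oplus : A → A → A) := ⟨oplus_assoc⟩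
      let _i2 : Std.Commutative (oplus : A → A → A) := ⟨oplus_comm⟩
      rw [nmul_add]
      ac_rfl
    rw [← e]
    exact oplus_le_oplus h h'
  mem_of_le := by
    rintro a b hab ⟨m, hm, n, h⟩
    exact ⟨m, hm, n, le_trans hab h⟩

/-- Adjoining an element outside `M` yields the whole algebra, so `1 ≤ m ⊕ na` with `m` in `M`; then
reduce modulo `M`. -/
theorem MVIdeal.IsMaximal.isArch {M : MVIdeal A} (hM : M.IsMaximal) : IsArch M.Quot := by
  intro x hx
  obtain ⟨a, rfl⟩ := M.proj_surjective x
  have hnot : ¬ (M.adjoin a).IsProper := fun hp => by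
    have e := hM.2 _ hp fun m hm => ⟨m, hm, 0, le_oplus_left _ _⟩
    refine hx (M.proj_eq_zero_iff.2 ?_)
    rw [← e]
    exact ⟨zero, M.zero_mem, 1, by rw [nmul_one_left, zero_oplus]; exact le_self a⟩
  have h1 : one ∈ (M.adjoin a).carrier := by
    rw [not_not.1 hnot]
    trivial
  obtain ⟨m, hm, n, h⟩ := h1
  refine ⟨n, le_antisymm (le_one _) ?_⟩
  have := M.isHom_proj.map_le h
  rwa [M.isHom_proj.map_one, M.isHom_proj.2.1, M.proj_eq_zero_iff.2 hm, zero_oplus,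
    M.isHom_proj.map_nmul] at this

theorem isEmbedding_iotaAt (M : MaxIdeal A) : IsEmbedding (iotaAt M) :=
  Classical.epsilon_spec (M.2.isArch.exists_isEmbedding M.2.1.zero_ne_one)

/-- The kernel of a homomorphism. -/
def ker {B : Type v} [MVAlgebra B] {f : A → B} (hf : IsHom f) : MVIdeal A where
  carrier := {a | f a = zero}
  zero_mem := hf.1
  oplus_mem := fun {a b} (ha : f a = zero) (hb : f b = zero) => by
    change f (oplus a b) = zero
    rw [hf.2.1, ha, hb, oplus_zero]
  mem_of_le := fun {a b} h (hb : f b = zero) =>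
    le_antisymm (by rw [← hb]; exact hf.map_le h) (zero_le _)

/-- The image of an ideal under a surjective homomorphism. -/
def MVIdeal.map {B : Type v} [MVAlgebra B] {f : A → B} (hf : IsHom f)
    (hs : Function.Surjective f) (I : MVIdeal A) : MVIdeal B where
  carrier := f '' I.carrier
  zero_mem := ⟨zero, I.zero_mem, hf.1⟩
  oplus_mem := by
    rintro _ _ ⟨a, ha, rfl⟩ ⟨b, hb, rfl⟩
    exact ⟨_, I.oplus_mem ha hb, hf.2.1 a b⟩
  mem_of_le := by
    rintro x _ h ⟨b, hb, rfl⟩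
    obtain ⟨a, rfl⟩ := hs x
    -- The witness is the meet `b ∧ a`: it lies below `b`, and its image is `f b ∧ f a = f a`.
    refine ⟨sub b (sub b a), I.mem_of_le (sub_le_iff.2 (le_oplus_right _ _)) hb, ?_⟩
    rw [hf.map_sub, hf.map_sub]
    have e := lukasiewicz (neg (f b)) (neg (f a))
    have h' : oplus (f b) (neg (f a)) = one := by rw [oplus_comm]; exact h
    rw [neg_neg_self, neg_neg_self, h', neg_one, zero_oplus] at e
    have k : sub (f b) (sub (f b) (f a)) = neg (oplus (neg (oplus (f a) (neg (f b)))) (neg (f b)))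
        := by
      rw [sub, sub, oplus_comm (neg (f b)) (f a), oplus_comm (neg (f b))]
    rw [k, ← e, neg_neg_self]

theorem isMaximal_ker {B : Type v} [MVAlgebra B] {f : A → B} (hf : IsHom f)
    (hs : Function.Surjective f) (hB : IsSimple B) : (ker hf).IsMaximal := by
  have h01 : (zero : B) ≠ one := fun h => by
    -- The kernel of the identity is the zero ideal, which simplicity declares proper.
    have hp := (hB (ker (f := fun b : B => b) ⟨rfl, fun _ _ => rfl, fun _ => rfl⟩)).2 rfl
    exact hp (MVIdeal.eq_univ_of_one_mem _ h.symm)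
  refine ⟨fun h => ?_, fun J hJ hle => Set.Subset.antisymm (fun a ha => ?_) hle⟩
  · have h1 : one ∈ (ker hf).carrier := by rw [h]; trivial
    have h2 : f one = zero := h1
    rw [hf.map_one] at h2
    exact h01 h2.symm
  · have hp : (J.map hf hs).IsProper := by
      intro h
      have h1 : one ∈ (J.map hf hs).carrier := by rw [h]; trivial
      obtain ⟨b, hb, hb1⟩ := h1
      refine hJ (J.eq_univ_of_one_mem ?_)
      rw [← neg_oplus_self b]
      -- If `f b = 1`, then `b*` lies in the kernel, hence in `J`, and `b* ⊕ b = 1`.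
      refine J.oplus_mem (hle ?_) hb
      change f (neg b) = zero
      rw [hf.2.2, hb1, neg_one]
    have e := (hB _).1 hp
    have : f a ∈ (J.map hf hs).carrier := ⟨a, ha, rfl⟩
    rw [e] at this
    exact this

/-- The kernels of the projections onto the given simple factors are maximal, so the maximal ideals
already separate points. -/
theorem IsSemisimple.isSubdirect_proj (hA : IsSemisimple A) :
    IsSubdirect (fun (a : A) (M : MaxIdeal A) => M.1.proj a) := by
  refine ⟨⟨⟨rfl, fun _ _ => rfl, fun _ => rfl⟩, fun a b hab => ?_⟩, fun M => M.1.proj_surjective⟩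
  obtain ⟨I, B, _, f, ⟨⟨hf, hinj⟩, hs⟩, hB⟩ := hA
  refine eq_of_dist_eq_zero (hinj ?_)
  rw [hf.1]
  funext i
  have hfi : IsHom fun a => f a i :=
    ⟨congrFun hf.1 i, fun a b => congrFun (hf.2.1 a b) i, fun a => congrFun (hf.2.2 a) i⟩
  have := congrFun hab ⟨ker hfi, isMaximal_ker hfi (hs i) (hB i)⟩
  exact (MVIdeal.proj_eq_proj_iff _).1 this

end Quotients

/-! ### Coordinates over the maximal ideals and separation by limit cuts. -/

section Spectrum

variable {A : Type u} [MVAlgebra A]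

theorem isHom_iota_apply (M : MaxIdeal A) : IsHom fun a : A => iota a M := by
  have h := (isEmbedding_iotaAt M).1
  exact ⟨h.1, fun a b => h.2.1 (M.1.proj a) (M.1.proj b), fun a => h.2.2 (M.1.proj a)⟩

theorem IsSemisimple.isEmbedding_iota (hA : IsSemisimple A) :
    IsEmbedding (iota : A → MaxIdeal A → unitInterval) := by
  refine ⟨⟨funext fun M => (isHom_iota_apply M).1, fun a b => funext fun M =>
    (isHom_iota_apply M).2.1 a b, fun a => funext fun M => (isHom_iota_apply M).2.2 a⟩, ?_⟩
  intro a b h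
  exact hA.isSubdirect_proj.1.2 (funext fun M => (isEmbedding_iotaAt M).2 (congrFun h M))

theorem pi_le_iff {I : Type u} {f g : I → unitInterval} : le f g ↔ f ≤ g := by
  constructor
  · intro h i
    exact le_iff_le.1 (congrFun h i)
  · intro h
    funext i
    exact le_iff_le.2 (h i)

theorem IsSemisimple.le_iff (hA : IsSemisimple A) {a b : A} : le a b ↔ iota a ≤ iota b := by
  rw [← pi_le_iff, hA.isEmbedding_iota.le_iff]

/-- The real number `â(M)`. -/
noncomputable def hat (a : A) (M : MaxIdeal A) : ℝ := iota a M

theorem hat_nonneg (a : A) (M : MaxIdeal A) : 0 ≤ hat a M := (iota a M).2.1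

theorem hat_le_one (a : A) (M : MaxIdeal A) : hat a M ≤ 1 := (iota a M).2.2

theorem IsSemisimple.le_iff_hat (hA : IsSemisimple A) {a b : A} :
    le a b ↔ ∀ M, hat a M ≤ hat b M := hA.le_iff

theorem hat_oplus (a b : A) (M : MaxIdeal A) :
    hat (oplus a b) M = min 1 (hat a M + hat b M) := by
  exact (congrArg Subtype.val ((isHom_iota_apply M).2.1 a b)).trans (coe_oplus _ _)

theorem hat_neg (a : A) (M : MaxIdeal A) : hat (neg a) M = 1 - hat a M := by
  exact (congrArg Subtype.val ((isHom_iota_apply M).2.2 a)).trans (coe_neg _)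

theorem hat_sub (a b : A) (M : MaxIdeal A) : hat (sub a b) M = max 0 (hat a M - hat b M) := by
  exact (congrArg Subtype.val ((isHom_iota_apply M).map_sub a b)).trans (coe_sub _ _)

theorem hat_sub_of_le {a b : A} {M : MaxIdeal A} (h : hat b M ≤ hat a M) :
    hat (sub a b) M = hat a M - hat b M := by
  rw [hat_sub, max_eq_right (sub_nonneg.2 h)]

theorem hat_nmul (n : ℕ) (a : A) (M : MaxIdeal A) :
    hat (nmul n a) M = min 1 (n * hat a M) := by
  exact (congrArg Subtype.val ((isHom_iota_apply M).map_nmul n a)).trans (coe_nmul _ _)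

/-- The meet of two elements. -/
def inf (a b : A) : A := sub a (sub a b)

/-- The join of two elements. -/
def sup (a b : A) : A := oplus a (sub b a)

theorem hat_inf (a b : A) (M : MaxIdeal A) : hat (inf a b) M = min (hat a M) (hat b M) := by
  have ha := hat_nonneg a M
  have hb := hat_nonneg b M
  rw [inf, hat_sub, hat_sub]
  rcases le_total (hat a M) (hat b M) with h | h
  · rw [min_eq_left h, max_eq_left (sub_nonpos.2 h), sub_zero, max_eq_right ha]
  · rw [min_eq_right h, max_eq_right (sub_nonneg.2 h), sub_sub_cancel, max_eq_right hb]

theorem hat_sup (a b : A) (M : MaxIdeal A) : hat (sup a b) M = max (hat a M) (hat b M) := by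
  have := hat_le_one a M
  have := hat_le_one b M
  rw [sup, hat_oplus, hat_sub]
  rcases le_total (hat a M) (hat b M) with h | h
  · rw [max_eq_right h, max_eq_right (by linarith), min_eq_right (by linarith)]; ring
  · rw [max_eq_left h, max_eq_left (by linarith), min_eq_right (by linarith)]; ring

/-- In a limit cut complete algebra, two sets whose gap is pointwise infinitesimal are separated
by an element. -/
theorem IsLimitCutComplete.exists_between (hA : IsLimitCutComplete A) {X Y : Set A}
    (hXY : ∀ x ∈ X, ∀ y ∈ Y, le x y)
    (hgap : ∀ (M : MaxIdeal A) (ε : ℝ), 0 < ε → ∃ x ∈ X, ∃ y ∈ Y, hat y M - hat x M ≤ ε) :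
    ∃ s, (∀ x ∈ X, le x s) ∧ ∀ y ∈ Y, le s y := by
  have hsub : X ⊆ lb (ub X) := fun x hx b hb => hb x hx
  have hub : ub (lb (ub X)) = ub X :=
    Set.Subset.antisymm (fun b hb x hx => hb x (hsub hx)) fun b hb x hx => hx b hb
  -- The cut generated by `X` contains `X` and has `Y` among its upper bounds, so the gap hypothesis
  -- makes it a limit cut.
  obtain ⟨s, hs, hs'⟩ := hA.2 (lb (ub X)) ⟨by rw [IsCut, hub], by
    refine ⟨fun δ _ M => (δ M).2.1, ?_⟩
    · intro δ hδ M
      refine le_of_forall_pos_le_add (α := ℝ) fun ε hε => ?_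
      obtain ⟨x, hx, y, hy, hxy⟩ := hgap M ε hε
      have h := hδ ⟨x, hsub hx, y, by rw [hub]; exact fun z hz => hXY z hz y hy, rfl⟩ M
      have h' : (δ M : ℝ) ≤ (dist (iota x M) (iota y M) : unitInterval) := h
      rw [coe_dist_of_le (hA.1.le_iff.1 (hXY x hx y hy) M)] at h'
      change (δ M : ℝ) ≤ 0 + ε
      rw [zero_add]
      exact h'.trans hxy⟩
  rw [hub] at hs hs'
  exact ⟨s, hs, fun y hy => hs' y fun x hx => hXY x hx y hy⟩

end Spectrum

/-! ### Surjectivity onto `[0, 1]` by nested intervals. -/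

section CompleteQuotients

variable {A : Type u} [MVAlgebra A]

/-- Truncating an element by `1 / (k + 1)`, without changing it where it is below that bound. -/
def trunc (k : ℕ) (e : A) : A := inf e (neg (nmul k e))

theorem hat_trunc_le_self (k : ℕ) (e : A) (M : MaxIdeal A) : hat (trunc k e) M ≤ hat e M := by
  rw [trunc, hat_inf]
  exact min_le_left _ _

/-- The functions `t` and `1 - kt` cross at `t = 1 / (k + 1)`, which is thus the largest value of
their minimum. -/
theorem hat_trunc_le (k : ℕ) (e : A) (M : MaxIdeal A) :
    hat (trunc k e) M ≤ 1 / ((k : ℝ) + 1) := by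
  have hk : (0 : ℝ) < k + 1 := by positivity
  rw [trunc, hat_inf, hat_neg, hat_nmul]
  rcases le_total (hat e M) (1 / ((k : ℝ) + 1)) with h | h
  · exact (min_le_left _ _).trans h
  · refine (min_le_right _ _).trans ?_
    have h1 : (k : ℝ) * (1 / (k + 1)) ≤ k * hat e M := by gcongr
    have h2 : (k : ℝ) * (1 / (k + 1)) = 1 - 1 / (k + 1) := by field_simp; ring
    have h3 : (0 : ℝ) < 1 / (k + 1) := by positivity
    have h4 : 1 - 1 / ((k : ℝ) + 1) ≤ min 1 (k * hat e M) := le_min (by linarith) (by linarith)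
    linarith

theorem hat_trunc_of_le {k : ℕ} {e : A} {M : MaxIdeal A} (h : hat e M ≤ 1 / ((k : ℝ) + 1)) :
    hat (trunc k e) M = hat e M := by
  have hk : (0 : ℝ) < k + 1 := by positivity
  rw [trunc, hat_inf, hat_neg, hat_nmul]
  refine min_eq_left ?_
  rw [le_div_iff₀ hk] at h
  have := min_le_right (1 : ℝ) (k * hat e M)
  nlinarith

/-- Nested intervals around `r` at the coordinate `M` can be shrunk uniformly. -/
theorem exists_refinement {M : MaxIdeal A} (hM : HasSmall M.1.Quot) {r : ℝ} {a b : A}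
    (hab : ∀ N, hat a N ≤ hat b N) (har : hat a M ≤ r) (hrb : r ≤ hat b M) (k : ℕ) :
    ∃ c d : A, (∀ N, hat a N ≤ hat c N ∧ hat c N ≤ hat d N ∧ hat d N ≤ hat b N ∧
      hat d N - hat c N ≤ 1 / ((k : ℝ) + 1)) ∧ hat c M ≤ r ∧ r ≤ hat d M := by
  obtain ⟨v, ht0, htk⟩ : ∃ v : A, 0 < hat v M ∧ hat v M ≤ 1 / ((k : ℝ) + 1) := by
    obtain ⟨w, hw0, hw⟩ := hM (k + 1)
    obtain ⟨v, rfl⟩ := M.1.proj_surjective w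
    have hemb := isEmbedding_iotaAt M
    refine ⟨v, lt_of_le_of_ne (hat_nonneg v M) fun h => hw0 (hemb.2 ?_), ?_⟩
    · rw [hemb.1.1]
      exact Subtype.ext h.symm
    · have hk : (0 : ℝ) < k + 1 := by positivity
      by_contra! hlt
      rw [div_lt_iff₀ hk] at hlt
      refine absurd (count_le (n := k + 1) (hemb.le_iff.1 ?_)) (not_le.2 hw)
      rw [hemb.1.map_one, hemb.1.map_nmul, le_iff_le, ← Subtype.coe_le_coe, coe_one, coe_nmul]
      refine le_min le_rfl ?_
      push_cast
      rw [mul_comm]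
      exact hlt.le
  have hr0 : 0 ≤ r := (hat_nonneg a M).trans har
  have hr1 : r ≤ 1 := hrb.trans (hat_le_one b M)
  set t := hat v M with ht
  -- Consecutive multiples of `t` bracket `r`; clamped to `[a, b]`, they give the new endpoints.
  obtain ⟨j, hj1, hj2⟩ : ∃ j : ℕ, j * t ≤ r ∧ r ≤ j * t + t := by
    refine ⟨⌊r / t⌋₊, (le_div_iff₀ ht0).1 (Nat.floor_le (by positivity)), ?_⟩
    have := (Nat.lt_floor_add_one (r / t)).le
    rw [div_le_iff₀ ht0] at this
    linarith
  let c := sup a (inf (nmul j v) b)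
  let d := sup c (inf (nmul (j + 1) v) b)
  have hc : ∀ N, hat c N = max (hat a N) (min (min 1 (j * hat v N)) (hat b N)) := fun N => by
    rw [hat_sup, hat_inf, hat_nmul]
  have hd : ∀ N, hat d N = max (hat c N) (min (min 1 ((j + 1 : ℕ) * hat v N)) (hat b N)) :=
    fun N => by rw [hat_sup, hat_inf, hat_nmul]
  have hac : ∀ N, hat a N ≤ hat c N := fun N => by rw [hc]; exact le_max_left _ _
  have hcd : ∀ N, hat c N ≤ hat d N := fun N => by rw [hd]; exact le_max_left _ _
  have hcb : ∀ N, hat c N ≤ hat b N := fun N => by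
    rw [hc]; exact max_le (hab N) (min_le_right _ _)
  have hdb : ∀ N, hat d N ≤ hat b N := fun N => by
    rw [hd]; exact max_le (hcb N) (min_le_right _ _)
  have hcM : hat c M ≤ r := by
    rw [hc]
    exact max_le har ((min_le_left _ _).trans ((min_le_right _ _).trans hj1))
  have hdM : r ≤ hat d M := by
    rw [hd]
    refine le_max_of_le_right (le_min (le_min hr1 ?_) hrb)
    push_cast
    linarith
  have hdc : hat d M - hat c M ≤ t := by
    have h1 : min (min 1 (j * t)) (hat b M) ≤ hat c M := by
      rw [hc]; exact le_max_right _ _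
    have h2 : min (min 1 ((j + 1 : ℕ) * t)) (hat b M) ≤ min (min 1 (j * t)) (hat b M) + t := by
      push_cast
      simp only [← min_add_add_right]
      refine le_min (le_min ?_ ?_) ?_
      · exact (min_le_left _ _).trans ((min_le_left _ _).trans (by linarith))
      · exact (min_le_left _ _).trans ((min_le_right _ _).trans (by linarith))
      · exact (min_le_right _ _).trans (by linarith)
    have h3 : hat d M ≤ hat c M + t := by
      rw [hd]
      exact max_le (by linarith) (by rw [← ht]; linarith)
    linarith
  have he : ∀ N, hat (sub d c) N = hat d N - hat c N := fun N => by
    rw [hat_sub, max_eq_right (by linarith [hcd N])]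
  -- The gap `d ⊖ c` is controlled only at `M`. Truncating it bounds the width at every coordinate
  -- and changes nothing at `M`, so `r` stays enclosed.
  have hd' : ∀ N, hat (oplus c (trunc k (sub d c))) N = hat c N + hat (trunc k (sub d c)) N :=
    fun N => by
      rw [hat_oplus, min_eq_right]
      have := hat_trunc_le_self k (sub d c) N
      rw [he] at this
      linarith [hat_le_one d N]
  refine ⟨c, oplus c (trunc k (sub d c)), fun N => ⟨hac N, ?_, ?_, ?_⟩, hcM, ?_⟩
  · rw [hd']; linarith [hat_nonneg (trunc k (sub d c)) N]
  · have := hat_trunc_le_self k (sub d c) N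
    rw [he] at this
    rw [hd']; linarith [hdb N]
  · rw [hd']; linarith [hat_trunc_le k (sub d c) N]
  · rw [hd', hat_trunc_of_le (by rw [he]; linarith), he]
    linarith

theorem IsLimitCutComplete.exists_hat_eq (hA : IsLimitCutComplete A) {M : MaxIdeal A}
    (hM : HasSmall M.1.Quot) {r : ℝ} (hr0 : 0 ≤ r) (hr1 : r ≤ 1) : ∃ s : A, hat s M = r := by
  let P : Type u := {p : A × A // (∀ N, hat p.1 N ≤ hat p.2 N) ∧ hat p.1 M ≤ r ∧ r ≤ hat p.2 M}
  have hstep : ∀ (k : ℕ) (p : P), ∃ q : P, (∀ N, hat p.1.1 N ≤ hat q.1.1 N) ∧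
      (∀ N, hat q.1.2 N ≤ hat p.1.2 N) ∧
      ∀ N, hat q.1.2 N - hat q.1.1 N ≤ 1 / ((k : ℝ) + 1) := by
    rintro k ⟨⟨a, b⟩, hab, har, hrb⟩
    obtain ⟨c, d, h, hc, hd⟩ := exists_refinement hM hab har hrb k
    exact ⟨⟨(c, d), fun N => (h N).2.1, hc, hd⟩, fun N => (h N).1, fun N => (h N).2.2.1,
      fun N => (h N).2.2.2⟩
  choose step hs1 hs2 hs3 using hstep
  have h0 : hat (zero : A) M = 0 := congrArg Subtype.val (isHom_iota_apply M).1
  let p₀ : P := ⟨(zero, one), hA.1.le_iff_hat.1 (zero_le _), by rwa [h0], by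
    rw [one, hat_neg, h0]
    simpa using hr1⟩
  let p : ℕ → P := fun n => Nat.rec p₀ step n
  have hlow : ∀ N, Monotone fun n => hat (p n).1.1 N := fun N =>
    monotone_nat_of_le_succ fun n => hs1 n (p n) N
  have hup : ∀ N, Antitone fun n => hat (p n).1.2 N := fun N =>
    antitone_nat_of_succ_le fun n => hs2 n (p n) N
  have hgap : ∀ (N : MaxIdeal A) (ε : ℝ), 0 < ε → ∃ n, hat (p n).1.2 N - hat (p n).1.1 N ≤ ε := by
    intro N ε hε
    obtain ⟨k, hk⟩ := exists_nat_one_div_lt hε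
    -- The bound `1 / (k + 1)` holds after step `k`, that is, for the pair of index `k + 1`.
    exact ⟨k + 1, (hs3 k (p k) N).trans hk.le⟩
  obtain ⟨s, hs, hs'⟩ := hA.exists_between (X := Set.range fun n => (p n).1.1)
    (Y := Set.range fun n => (p n).1.2) (by
      rintro _ ⟨m, rfl⟩ _ ⟨n, rfl⟩
      refine hA.1.le_iff_hat.2 fun N => ?_
      exact (hlow N (le_max_left m n)).trans (((p (max m n)).2.1 N).trans
        (hup N (le_max_right m n)))) (by
      intro N ε hε
      obtain ⟨n, hn⟩ := hgap N ε hε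
      exact ⟨_, ⟨n, rfl⟩, _, ⟨n, rfl⟩, hn⟩)
  refine ⟨s, _root_.le_antisymm ?_ ?_⟩
  · refine le_of_forall_pos_le_add fun ε hε => ?_
    obtain ⟨n, hn⟩ := hgap M ε hε
    have h1 := hA.1.le_iff_hat.1 (hs' _ ⟨n, rfl⟩) M
    have h2 := (p n).2.2.1
    dsimp only at h1
    linarith
  · refine le_of_forall_pos_le_add fun ε hε => ?_
    obtain ⟨n, hn⟩ := hgap M ε hε
    have h1 := hA.1.le_iff_hat.1 (hs _ ⟨n, rfl⟩) M
    have h2 := (p n).2.2.2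
    dsimp only at h1
    linarith

theorem IsLimitCutComplete.isomorphic_quot (hA : IsLimitCutComplete A) (M : MaxIdeal A) :
    Isomorphic M.1.Quot unitInterval ∨ ∃ n : ℕ, 1 ≤ n ∧ Isomorphic M.1.Quot (LukChain n) := by
  refine (M.2.isArch.hasSmall_or_isomorphic M.2.1.zero_ne_one).imp_left fun hM => ?_
  have hemb := isEmbedding_iotaAt M
  refine ⟨iotaAt M, hemb.1, hemb.2, fun r => ?_⟩
  obtain ⟨s, hs⟩ := hA.exists_hat_eq hM r.2.1 r.2.2
  exact ⟨M.1.proj s, Subtype.ext hs⟩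

end CompleteQuotients

/-! ### From the three kinds of density to pointwise approximation. -/

section Density

variable {A : Type u} [MVAlgebra A]

/-- `[a, b]` approximates `α` pointwise from below and from above. -/
def Approximates (a b : A) (α : MaxIdeal A → unitInterval) : Prop :=
  ∀ (M : MaxIdeal A) (ε : ℝ), 0 < ε →
    (∃ c ∈ interval a b, iota c ≤ α ∧ α M - ε ≤ hat c M) ∧
    ∃ c ∈ interval a b, α ≤ iota c ∧ hat c M ≤ α M + ε

/-- The elements of `[a, b]` below `α` and those above it have pointwise vanishing gap. A separating
element is squeezed onto `α`, and lies in `[a, b]` since `a` and `b` belong to the two sets. -/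
theorem IsLimitCutComplete.mem_image_of_approximates (hA : IsLimitCutComplete A) {a b : A}
    {α : MaxIdeal A → unitInterval} (hab : le a b) (hα : α ∈ Set.Icc (iota a) (iota b))
    (h : Approximates a b α) : α ∈ iota '' interval a b := by
  obtain ⟨s, hs, hs'⟩ := hA.exists_between (X := {c | c ∈ interval a b ∧ iota c ≤ α})
    (Y := {c | c ∈ interval a b ∧ α ≤ iota c})
    (fun x hx y hy => hA.1.le_iff.2 (hx.2.trans hy.2)) fun M ε hε => by
      obtain ⟨⟨c, hc, hcα, hc'⟩, d, hd, hdα, hd'⟩ := h M (ε / 2) (half_pos hε)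
      exact ⟨c, ⟨hc, hcα⟩, d, ⟨hd, hdα⟩, by linarith⟩
  refine ⟨s, ⟨hs a ⟨⟨le_self a, hab⟩, hα.1⟩, hs' b ⟨⟨hab, le_self b⟩, hα.2⟩⟩, ?_⟩
  funext M
  refine _root_.le_antisymm (le_of_forall_pos_le_add (α := ℝ) fun ε hε => ?_)
    (le_of_forall_pos_le_add (α := ℝ) fun ε hε => ?_)
  · obtain ⟨-, d, hd, hdα, hd'⟩ := h M ε hε
    exact (hA.1.le_iff_hat.1 (hs' d ⟨hd, hdα⟩) M).trans hd'
  · obtain ⟨⟨c, hc, hcα, hc'⟩, -⟩ := h M ε hε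
    have : hat c M ≤ iota s M := hA.1.le_iff_hat.1 (hs c ⟨hc, hcα⟩) M
    linarith

/-- Suprema and infima in the product are coordinatewise, so a failure at `M` would give a better
bound there than `α M`. -/
theorem approximates_of_joinMeetDense {a b : A} (hab : le a b)
    (h : JoinMeetDense (iota '' interval a b) (Set.Icc (iota a) (iota b)))
    {α : MaxIdeal A → unitInterval} (hα : α ∈ Set.Icc (iota a) (iota b)) :
    Approximates a b α := by
  intro M ε hε
  obtain ⟨⟨X, hX, hXα⟩, Y, hY, hYα⟩ := h α hα
  constructor
  · by_contra! hlt
    have ha : hat a M < α M - ε := hlt a ⟨le_self a, hab⟩ hα.1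
    have hmem : (α M : ℝ) - ε ∈ Set.Icc (0 : ℝ) 1 :=
      ⟨(hat_nonneg a M).trans ha.le, by linarith [(α M).2.2]⟩
    have h1 := (isLUB_pi.1 hXα M).2 (show (⟨_, hmem⟩ : unitInterval) ∈ _ from by
      rintro _ ⟨γ, hγ, rfl⟩
      obtain ⟨c, hc, rfl⟩ := hX hγ
      exact (hlt c hc (hXα.1 hγ)).le)
    have h2 : (α M : ℝ) ≤ α M - ε := h1
    linarith
  · by_contra! hlt
    have hb : α M + ε < hat b M := hlt b ⟨hab, le_self b⟩ hα.2
    have hmem : (α M : ℝ) + ε ∈ Set.Icc (0 : ℝ) 1 :=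
      ⟨by linarith [(α M).2.1], hb.le.trans (hat_le_one b M)⟩
    have h1 := (isGLB_pi.1 hYα M).2 (show (⟨_, hmem⟩ : unitInterval) ∈ _ from by
      rintro _ ⟨γ, hγ, rfl⟩
      obtain ⟨c, hc, rfl⟩ := hY hγ
      exact (hlt c hc (hYα.1 hγ)).le)
    have h2 : (α M : ℝ) + ε ≤ α M := h1
    linarith

open Classical in
-- Moving `α` by `ε` at `M` alone gives a comparable pair, and an element between the two is the
-- required approximation. If the move left the interval, the endpoint `a` or `b` would serve.
theorem approximates_of_orderDense {a b : A} (hab : le a b)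
    (h : OrderDense (iota '' interval a b) (Set.Icc (iota a) (iota b)))
    {α : MaxIdeal A → unitInterval} (hα : α ∈ Set.Icc (iota a) (iota b)) :
    Approximates a b α := by
  intro M ε hε
  constructor
  · by_contra! hlt
    have ha : hat a M < α M - ε := hlt a ⟨le_self a, hab⟩ hα.1
    have hmem : (α M : ℝ) - ε ∈ Set.Icc (0 : ℝ) 1 :=
      ⟨(hat_nonneg a M).trans ha.le, by linarith [(α M).2.2]⟩
    let r : unitInterval := ⟨_, hmem⟩
    have hr : r < α M := show (α M : ℝ) - ε < α M by linarith
    have hle : iota a ≤ Function.update α M r :=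
      le_update_iff.2 ⟨ha.le, fun N _ => hα.1 N⟩
    obtain ⟨_, ⟨c, hc, rfl⟩, hc1, hc2⟩ := h (Function.update α M r)
      ⟨hle, (update_le_self_iff.2 hr.le).trans hα.2⟩ α hα (update_lt_self_iff.2 hr)
    have h1 := hc1 M
    rw [Function.update_self] at h1
    exact absurd (hlt c hc hc2) (not_lt.2 h1)
  · by_contra! hlt
    have hb : α M + ε < hat b M := hlt b ⟨hab, le_self b⟩ hα.2
    have hmem : (α M : ℝ) + ε ∈ Set.Icc (0 : ℝ) 1 :=
      ⟨by linarith [(α M).2.1], hb.le.trans (hat_le_one b M)⟩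
    let r : unitInterval := ⟨_, hmem⟩
    have hr : α M < r := show (α M : ℝ) < α M + ε by linarith
    have hle : Function.update α M r ≤ iota b :=
      update_le_iff.2 ⟨hb.le, fun N _ => hα.2 N⟩
    obtain ⟨_, ⟨c, hc, rfl⟩, hc1, hc2⟩ := h α hα (Function.update α M r)
      ⟨hα.1.trans (le_update_self_iff.2 hr.le), hle⟩ (lt_update_self_iff.2 hr)
    have h1 := hc2 M
    rw [Function.update_self] at h1
    exact absurd (hlt c hc hc1) (not_lt.2 h1)

open Classical in
/-- Uniform density in a nondegenerate direction yields a characteristic function of a point. -/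
theorem exists_hat_eq_single_of_uniformlyDense {a b : A} (hab : iota a ≤ iota b)
    (h : UniformlyDense (iota '' interval a b) (Set.Icc (iota a) (iota b)))
    {M : MaxIdeal A} (hM : hat a M < hat b M) :
    ∃ g : A, hat g M = 1 ∧ ∀ N, N ≠ M → hat g N = 0 := by
  set w := hat b M - hat a M with hw
  have hw0 : 0 < w := by linarith
  -- This `k` makes `k e` reach `1` at `M`, where `e ≥ w / 2`; the tolerance `1 / (k + 1)` gives `(k
  -- + 1) e ≤ 1` elsewhere.
  obtain ⟨k, hk⟩ := exists_nat_gt (2 / w)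
  rw [div_lt_iff₀ hw0] at hk
  have hε : 0 < min (w / 2) (1 / ((k : ℝ) + 1)) := by positivity
  obtain ⟨_, ⟨c, hc, rfl⟩, hcε⟩ := h (Function.update (iota a) M (iota b M))
    ⟨le_update_self_iff.2 hM.le, update_le_iff.2 ⟨le_rfl, fun N _ => hab N⟩⟩ _ hε
  set e := sub c a with he
  have heM : w / 2 ≤ hat e M := by
    have h1 := hcε M
    rw [Function.update_self] at h1
    have h2 : |hat c M - hat b M| ≤ w / 2 := h1.trans (min_le_left _ _)
    rw [he, hat_sub]
    refine le_max_of_le_right ?_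
    linarith [neg_le_of_abs_le h2]
  have heN : ∀ N, N ≠ M → hat e N ≤ 1 / ((k : ℝ) + 1) := fun N hN => by
    have h1 := hcε N
    rw [Function.update_of_ne hN] at h1
    have h2 : |hat c N - hat a N| ≤ 1 / ((k : ℝ) + 1) := h1.trans (min_le_right _ _)
    rw [he, hat_sub]
    exact max_le (by positivity) (le_of_abs_le h2)
  have hkM : hat (nmul k e) M = 1 := by
    rw [hat_nmul, min_eq_left]
    nlinarith
  -- Subtracting `1 - ke` leaves `e` intact at `M` and kills it elsewhere; the factor `k` then
  -- restores the value `1` at `M`.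
  refine ⟨nmul k (sub e (neg (nmul k e))), ?_, fun N hN => ?_⟩
  · rw [← hkM, hat_nmul, hat_nmul, hat_sub, hat_neg, hkM, _root_.sub_self, sub_zero,
      max_eq_right (hat_nonneg e M)]
  · have h1 := heN N hN
    rw [le_div_iff₀ (by positivity)] at h1
    have h2 := min_le_right (1 : ℝ) (k * hat e N)
    rw [hat_nmul, hat_sub, hat_neg, hat_nmul, max_eq_left (by linarith), mul_zero,
      min_eq_right zero_le_one]

open Classical in
-- A uniform approximation may lie on the wrong side of `α` away from `M`. The characteristic
-- function `g` of `M` splices it at `M` with an endpoint elsewhere.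
theorem IsSemisimple.approximates_of_uniformlyDense (hA : IsSemisimple A) {a b : A} (hab : le a b)
    (h : UniformlyDense (iota '' interval a b) (Set.Icc (iota a) (iota b)))
    {α : MaxIdeal A → unitInterval} (hα : α ∈ Set.Icc (iota a) (iota b)) :
    Approximates a b α := by
  intro M ε hε
  have hcoord : ∀ r : unitInterval, iota a M ≤ r → r ≤ iota b M →
      ∃ c ∈ interval a b, |hat c M - r| ≤ ε / 2 := fun r h1 h2 => by
    obtain ⟨_, ⟨c, hc, rfl⟩, hcε⟩ := h (Function.update α M r)
      ⟨le_update_iff.2 ⟨h1, fun N _ => hα.1 N⟩, update_le_iff.2 ⟨h2, fun N _ => hα.2 N⟩⟩ _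
      (half_pos hε)
    have h3 := hcε M
    rw [Function.update_self] at h3
    exact ⟨c, hc, h3⟩
  have haM : hat a M ≤ α M := hα.1 M
  have hbM : α M ≤ hat b M := hα.2 M
  constructor
  · by_contra! hlt
    have ha : hat a M < α M - ε := hlt a ⟨le_self a, hab⟩ hα.1
    have hmem : (α M : ℝ) - ε / 2 ∈ Set.Icc (0 : ℝ) 1 :=
      ⟨by linarith [hat_nonneg a M], by linarith [(α M).2.2]⟩
    obtain ⟨g, hgM, hgN⟩ := exists_hat_eq_single_of_uniformlyDense (hA.le_iff.1 hab) h
      (M := M) (by linarith)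
    -- Aiming at `α M - ε / 2` with error `ε / 2` keeps the value between `α M - ε` and `α M`.
    obtain ⟨c, hc, hcε⟩ := hcoord ⟨_, hmem⟩ (show hat a M ≤ α M - ε / 2 by linarith)
      (show (α M : ℝ) - ε / 2 ≤ hat b M by linarith)
    obtain ⟨hc1, hc2⟩ := abs_le.1 hcε
    have hac := hA.le_iff_hat.1 hc.1
    -- Equal to `c` at `M` and to `a` elsewhere.
    let d := oplus a (inf (sub c a) g)
    have hdM : hat d M = hat c M := by
      rw [hat_oplus, hat_inf, hat_sub_of_le (hac M), hgM,
        min_eq_left (a := hat c M - hat a M) (by linarith [hat_nonneg a M, hat_le_one c M]),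
        add_sub_cancel, min_eq_right (hat_le_one c M)]
    have hdN : ∀ N, N ≠ M → hat d N = hat a N := fun N hN => by
      rw [hat_oplus, hat_inf, hat_sub, hgN N hN, min_eq_right (le_max_left _ _), add_zero,
        min_eq_right (hat_le_one a N)]
    have hdα : iota d ≤ α := fun N => by
      change hat d N ≤ α N
      by_cases hN : N = M
      · subst hN
        rw [hdM]
        dsimp only at hc2
        linarith
      · rw [hdN N hN]
        exact hα.1 N
    have := hlt d ⟨le_oplus_left _ _, hA.le_iff.2 (hdα.trans hα.2)⟩ hdα
    rw [hdM] at this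
    dsimp only at hc1
    linarith
  · by_contra! hlt
    have hb : α M + ε < hat b M := hlt b ⟨hab, le_self b⟩ hα.2
    have hmem : (α M : ℝ) + ε / 2 ∈ Set.Icc (0 : ℝ) 1 :=
      ⟨by linarith [(α M).2.1], by linarith [hat_le_one b M]⟩
    obtain ⟨g, hgM, hgN⟩ := exists_hat_eq_single_of_uniformlyDense (hA.le_iff.1 hab) h
      (M := M) (by linarith)
    obtain ⟨c, hc, hcε⟩ := hcoord ⟨_, hmem⟩ (show hat a M ≤ α M + ε / 2 by linarith)
      (show (α M : ℝ) + ε / 2 ≤ hat b M by linarith)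
    obtain ⟨hc1, hc2⟩ := abs_le.1 hcε
    have hcb := hA.le_iff_hat.1 hc.2
    -- Equal to `c` at `M` and to `b` elsewhere.
    let d := sub b (inf (sub b c) g)
    have hdM : hat d M = hat c M := by
      rw [hat_sub, hat_inf, hat_sub_of_le (hcb M), hgM,
        min_eq_left (a := hat b M - hat c M) (by linarith [hat_nonneg c M, hat_le_one b M]),
        sub_sub_cancel, max_eq_right (hat_nonneg c M)]
    have hdN : ∀ N, N ≠ M → hat d N = hat b N := fun N hN => by
      rw [hat_sub, hat_inf, hat_sub, hgN N hN, min_eq_right (le_max_left _ _), sub_zero,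
        max_eq_right (hat_nonneg b N)]
    have hdα : α ≤ iota d := fun N => by
      change α N ≤ hat d N
      by_cases hN : N = M
      · subst hN
        rw [hdM]
        dsimp only at hc1
        linarith
      · rw [hdN N hN]
        exact hα.2 N
    have := hlt d ⟨hA.le_iff.2 (hα.1.trans hdα), sub_le_iff.2 (le_oplus_right _ _)⟩ hdα
    rw [hdM] at this
    dsimp only at hc2
    linarith

end Density

end MV

theorem theorem5p1 {A : Type u} [MVAlgebra A] (hA : MV.IsLimitCutComplete A) :
    (∀ a b : A, MV.le a b →
      (MV.OrderDense (MV.iota '' MV.interval a b) (Set.Icc (MV.iota a) (MV.iota b)) ∨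
        MV.JoinMeetDense (MV.iota '' MV.interval a b) (Set.Icc (MV.iota a) (MV.iota b)) ∨
        MV.UniformlyDense (MV.iota '' MV.interval a b) (Set.Icc (MV.iota a) (MV.iota b))) →
      MV.iota '' MV.interval a b = Set.Icc (MV.iota a) (MV.iota b)) ∧
    MV.IsSubdirect (fun (a : A) (M : MV.MaxIdeal A) => M.1.proj a) ∧
    ∀ M : MV.MaxIdeal A,
      MV.IsMVChain M.1.Quot ∧ MV.IsComplete M.1.Quot ∧
      (MV.Isomorphic M.1.Quot unitInterval ∨
        ∃ n : ℕ, 1 ≤ n ∧ MV.Isomorphic M.1.Quot (MV.LukChain n)) := by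
  refine ⟨fun a b hab h => Set.Subset.antisymm ?_ fun α hα => ?_, hA.1.isSubdirect_proj,
    fun M => ⟨M.2.isArch.isMVChain, ?_, hA.isomorphic_quot M⟩⟩
  · rintro _ ⟨c, hc, rfl⟩
    exact ⟨hA.1.le_iff.1 hc.1, hA.1.le_iff.1 hc.2⟩
  · refine hA.mem_image_of_approximates hab hα ?_
    rcases h with h | h | h
    · exact MV.approximates_of_orderDense hab h hα
    · exact MV.approximates_of_joinMeetDense hab h hα
    · exact hA.1.approximates_of_uniformlyDense hab h hα
  · rcases hA.isomorphic_quot M with h | ⟨n, hn, h⟩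
    · exact MV.isComplete_unitInterval.of_isomorphic h
    · exact (MV.isComplete_lukChain hn).of_isomorphic h
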